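/- For $\beta\in(0,1]$ let $\mathrm{E}_\beta(z)=\sum_{n=0}^\infty \frac{z^n}{\Gamma(\beta n+1)}$, $z\in\mathbb{C}$, be the Mittag-Leffler function, and for $d\in\{1,2\}$ let $\mu_\beta^d$ be the Mittag-Leffler measure on $\mathbb{R}^d$, i.e. the unique probability measure with \[ \int_{\mathbb{R}^d}\exp(\mathrm{i}(p,x))\,\mathrm{d}\mu_\beta^d(x)=\mathrm{E}_\beta\Bigl(-\frac12(p,p)\Bigr)\quad\text{for all }p\in\mathbb{R}^d. \] Let $H_n^\beta$, $n=0,1,2,\dots$, be the monic polynomials with $\deg H_n^\beta=n$ obtained by applying Gram--Schmidt orthogonalization (without normalization) to the monomials $1,x,x^2,\dots$ in $L^2(\mathbb{R},\mu_\beta^1)$. Then, for every $\beta\in(0,1]$, the function $(x,y)\mapsto H_4^\beta(x)H_2^\beta(y)$ is integrable with respect to $\mu_\beta^2$, and \[ \int_{\mathbb{R}^2}H_4^\beta(x)H_2^\beta(y)\,\mathrm{d}\mu_\beta^2(x,y)=0\quad\text{if and only if}\quad\beta=1. \] -/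

import Mathlib

open MeasureTheory

noncomputable section

/-- The Mittag-Leffler function `E_β(z) = ∑ zⁿ / Γ(β n + 1)`. -/
def mittagLeffler (β : ℝ) (z : ℂ) : ℂ :=
  ∑' n : ℕ, z ^ n / Complex.Gamma (β * n + 1)

/-- `μ` is a probability measure with characteristic function `p ↦ E_β(-(p,p)/2)`. -/
def IsMittagLefflerMeasure {E : Type*} [NormedAddCommGroup E] [InnerProductSpace ℝ E]
    [MeasurableSpace E] (β : ℝ) (μ : Measure E) : Prop :=
  IsProbabilityMeasure μ ∧
    ∀ p : E, charFun μ p = mittagLeffler β (-(1 / 2) * (inner ℝ p p : ℝ))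

/-- A measure is determined by its characteristic function, so there is at most one
Mittag-Leffler measure on a given Euclidean space. -/
theorem IsMittagLefflerMeasure.unique {E : Type*} [NormedAddCommGroup E] [InnerProductSpace ℝ E]
    [FiniteDimensional ℝ E] [MeasurableSpace E] [BorelSpace E] {β : ℝ} {μ ν : Measure E}
    (hμ : IsMittagLefflerMeasure β μ) (hν : IsMittagLefflerMeasure β ν) : μ = ν := by
  have := hμ.1
  have := hν.1
  have : CompleteSpace E := FiniteDimensional.complete ℝ E
  exact Measure.ext_of_charFun (funext fun p => (hμ.2 p).trans (hν.2 p).symm)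

open Classical in
/-- The Mittag-Leffler measure `μ_β` on the Euclidean space `E`: the unique probability measure
with characteristic function `p ↦ E_β(-(p,p)/2)`. (The value `0` is only there to make the
definition total.) -/
def mittagLefflerMeasure (β : ℝ) (E : Type*) [NormedAddCommGroup E] [InnerProductSpace ℝ E]
    [MeasurableSpace E] : Measure E :=
  if h : ∃ μ : Measure E, IsMittagLefflerMeasure β μ then h.choose else 0

/-- The monic polynomials obtained from the monomials `1, x, x², …` by Gram-Schmidt
orthogonalization (without normalization) in `L²(ℝ, μ)`. -/
def gramSchmidtPoly (μ : Measure ℝ) (n : ℕ) : Polynomial ℝ :=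
  Polynomial.X ^ n - ∑ k : Fin n,
    Polynomial.C ((∫ x, x ^ n * (gramSchmidtPoly μ k).eval x ∂μ) /
      ∫ x, (gramSchmidtPoly μ k).eval x ^ 2 ∂μ) * gramSchmidtPoly μ k
termination_by n
decreasing_by all_goals exact k.2

/-- The polynomials `H_n^β`, orthogonal in `L²(ℝ, μ_β)` for the one-dimensional measure. -/
def mittagLefflerPoly (β : ℝ) (n : ℕ) : Polynomial ℝ :=
  gramSchmidtPoly (mittagLefflerMeasure β ℝ) n

end

open MeasureTheory Filter Topology
open scoped Nat

/-! The planar measure is a Gaussian mixture: it is the law of √T·(X, Y) with X, Y independent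
standard normals and T ≥ 0 independent of them with moments m!/Γ(βm+1). Expanding the exponential
termwise gives T the Laplace transform s ↦ E_β(-s), so the mixture has the required characteristic
function, and its mixed moments factor into a moment of √T and Gaussian moments. The law T is built
in `exists_mixing_measure` as a limit of rescaled Chinese restaurant counts smoothed by Gamma
variables.

Vanishing odd moments make H₂ and H₄ explicit. With Γₖ = Γ(kβ+1), the integral is then a positive
multiple of 3Γ₂² - Γ₁Γ₃ - 3Γ₁²Γ₂. This vanishes at β = 1, and `three_mul_Gamma_sq_lt` shows that it
is negative for β < 1. -/

/-! ### Limits of moment sequences -/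

/-- On the half-line, a limit of moment sequences of probability measures is again the moment
sequence of a probability measure. -/
theorem exists_isProbabilityMeasure_of_tendsto_moments (ν : ℕ → Measure ℝ)
    (hν : ∀ n, IsProbabilityMeasure (ν n)) (hpos : ∀ n, ∀ᵐ t ∂ν n, 0 ≤ t)
    (h_int : ∀ n m : ℕ, Integrable (fun t => t ^ m) (ν n)) (c : ℕ → ℝ)
    (hc : ∀ m : ℕ, Tendsto (fun n => ∫ t, t ^ m ∂ν n) atTop (𝓝 (c m))) :
    ∃ ρ : Measure ℝ, IsProbabilityMeasure ρ ∧ (∀ᵐ t ∂ρ, 0 ≤ t) ∧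
      ∀ m : ℕ, Integrable (fun t => t ^ m) ρ ∧ ∫ t, t ^ m ∂ρ = c m := by
  have hbdd : ∀ m : ℕ, ∃ C : ℝ, 0 ≤ C ∧ ∀ n, ∫ t, t ^ m ∂ν n ≤ C := by
    intro m
    obtain ⟨C, hC⟩ := (hc m).bddAbove_range
    exact ⟨max C 0, le_max_right _ _, fun n => (hC ⟨n, rfl⟩).trans (le_max_left _ _)⟩
  choose C hC0 hC using hbdd
  -- tightness
  let u : ℕ → NNReal := fun j => (C 1).toNNReal * (1 / ((j : NNReal) + 1))
  have hu : Tendsto u atTop (𝓝 0) := by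
    simpa [u] using
      (tendsto_one_div_add_atTop_nhds_zero_nat (𝕜 := NNReal)).const_mul (C 1).toNNReal
  let K : ℕ → Set ℝ := fun j => Set.Icc 0 ((j : ℝ) + 1)
  have hcpt := isCompact_setOfPred_probabilityMeasure_mass_eq_compl_isCompact_le (K := K) hu
    (fun n => isCompact_Icc) (Or.inl inferInstance)
  let P : ℕ → ProbabilityMeasure ℝ := fun n => ⟨ν n, hν n⟩
  have hmem : ∀ n, P n ∈ {μ : ProbabilityMeasure ℝ | ∀ n, μ (K n)ᶜ ≤ u n} := by
    intro n j
    have h1 : (ν n).real (K j)ᶜ ≤ C 1 * (1 / ((j : ℝ) + 1)) := by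
      have h2 : (ν n).real (K j)ᶜ = (ν n).real {t | (j : ℝ) + 1 < t} := by
        apply measureReal_congr
        filter_upwards [hpos n] with t ht
        apply propext
        change t ∈ (K j)ᶜ ↔ t ∈ {t | (j : ℝ) + 1 < t}
        simp [K, ht]
      have h3 := mul_meas_ge_le_integral_of_nonneg (μ := ν n) (f := fun t => t ^ 1)
        (by filter_upwards [hpos n] with t ht; simpa using ht) (h_int n 1) ((j : ℝ) + 1)
      have h4 : (ν n).real {t | (j : ℝ) + 1 < t} ≤ (ν n).real {t | (j : ℝ) + 1 ≤ t ^ 1} :=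
        measureReal_mono (fun t (ht : (j : ℝ) + 1 < t) => by simpa using ht.le)
      rw [h2, mul_one_div, le_div_iff₀ (by positivity), mul_comm]
      exact (mul_le_mul_of_nonneg_left h4 (by positivity)).trans (h3.trans (hC 1 n))
    rw [← NNReal.coe_le_coe]
    have h5 : ((u j : NNReal) : ℝ) = C 1 * (1 / ((j : ℝ) + 1)) := by
      simp [u, Real.coe_toNNReal _ (hC0 1)]
    rw [h5]
    exact h1
  -- A limit along a nonprincipal ultrafilter replaces the extraction of a weakly convergent
  -- subsequence.
  obtain ⟨ρ, hρ, hlim⟩ := hcpt.ultrafilter_le_nhds ((hyperfilter ℕ).map P)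
    (le_principal_iff.2 (Eventually.of_forall hmem : ∀ᶠ n in (hyperfilter ℕ : Filter ℕ), _))
  have hlim' : Tendsto P (hyperfilter ℕ) (𝓝 ρ) := hlim
  have hρ0 : ∀ᵐ t ∂(ρ : Measure ℝ), 0 ≤ t := by
    rw [ae_iff]
    have h1 : ∀ j, (ρ : Measure ℝ) {t | ¬ 0 ≤ t} ≤ (u j : ENNReal) := by
      intro j
      refine (measure_mono (t := (K j)ᶜ) ?_).trans ?_
      · intro t ht h
        exact ht h.1
      · rw [← ProbabilityMeasure.ennreal_coeFn_eq_coeFn_toMeasure]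
        exact ENNReal.coe_le_coe.2 (hρ j)
    have h2 : Tendsto (fun j => (u j : ENNReal)) atTop (𝓝 0) := by
      simpa using ENNReal.tendsto_coe.2 hu
    exact le_antisymm (ge_of_tendsto' h2 h1) bot_le
  refine ⟨ρ, inferInstance, hρ0, fun m => ?_⟩
  -- truncated moments
  let f : ℕ → ℝ → ℝ := fun A t => (max 0 (min t A)) ^ m
  have hfc : ∀ A, Continuous (f A) := fun A => by fun_prop
  have hf0 : ∀ A t, 0 ≤ f A t := fun A t => by positivity
  have hfb : ∀ A t, f A t ≤ (A : ℝ) ^ m := fun A t => by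
    simp only [f]
    gcongr
    exact max_le (by positivity) (min_le_right _ _)
  let F : ∀ A : ℕ, BoundedContinuousFunction ℝ ℝ := fun A =>
    BoundedContinuousFunction.ofNormedAddCommGroup (f A) (hfc A) ((A : ℝ) ^ m) (fun t => by
      rw [Real.norm_of_nonneg (hf0 A t)]; exact hfb A t)
  have hFint : ∀ (A : ℕ) (μ : Measure ℝ) [IsProbabilityMeasure μ], Integrable (f A) μ :=
    fun A μ _ => (F A).integrable μ
  have hFlim : ∀ A, Tendsto (fun n => ∫ t, f A t ∂ν n) (hyperfilter ℕ)
      (𝓝 (∫ t, f A t ∂(ρ : Measure ℝ))) := fun A =>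
    (ProbabilityMeasure.tendsto_iff_forall_integral_tendsto.1 hlim') (F A)
  have hcm : Tendsto (fun n => ∫ t, t ^ m ∂ν n) (hyperfilter ℕ) (𝓝 (c m)) :=
    (hc m).mono_left Nat.hyperfilter_le_atTop
  have hup : ∀ A, ∫ t, f A t ∂(ρ : Measure ℝ) ≤ c m := fun A =>
    le_of_tendsto_of_tendsto' (hFlim A) hcm fun n => by
      have := hν n
      refine integral_mono_ae (hFint A _) (h_int n m) ?_
      filter_upwards [hpos n] with t ht
      simp only [f]
      gcongr
      exact max_le ht (min_le_left _ _)
  -- Since t^m ≤ t^(m+1)/(A+1) once t ≥ A+1, the bound on the next moment controls the truncation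
  -- error uniformly in n.
  have hlow : ∀ A : ℕ, c m - C (m + 1) * (1 / ((A : ℝ) + 1)) ≤
      ∫ t, f (A + 1) t ∂(ρ : Measure ℝ) := fun A =>
    le_of_tendsto_of_tendsto' (hcm.sub_const _) (hFlim (A + 1)) fun n => by
      have := hν n
      have h1 : ∫ t, t ^ m ∂ν n ≤ ∫ t, (f (A + 1) t + t ^ (m + 1) * (1 / ((A : ℝ) + 1))) ∂ν n := by
        refine integral_mono_ae (h_int n m) ((hFint _ _).add ((h_int n (m + 1)).mul_const _)) ?_
        filter_upwards [hpos n] with t ht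
        rcases le_total t ((A : ℝ) + 1) with h | h
        · have : f (A + 1) t = t ^ m := by
            simp [f, h, ht]
          rw [this]
          have : 0 ≤ t ^ (m + 1) * (1 / ((A : ℝ) + 1)) := by positivity
          simpa using this
        · have h2 : t ^ m ≤ t ^ (m + 1) * (1 / ((A : ℝ) + 1)) := by
            rw [mul_one_div, le_div_iff₀ (by positivity), pow_succ]
            gcongr
          have := hf0 (A + 1) t
          linarith
      rw [integral_add (hFint _ _) ((h_int n (m + 1)).mul_const _), integral_mul_const] at h1
      have h3 : (∫ t, t ^ (m + 1) ∂ν n) * (1 / ((A : ℝ) + 1)) ≤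
          C (m + 1) * (1 / ((A : ℝ) + 1)) := by
        gcongr
        exact hC (m + 1) n
      linarith
  have hconv : Tendsto (fun A : ℕ => ∫ t, f (A + 1) t ∂(ρ : Measure ℝ)) atTop (𝓝 (c m)) := by
    refine tendsto_of_tendsto_of_tendsto_of_le_of_le ?_ tendsto_const_nhds hlow
      (fun A => hup (A + 1))
    simpa using (tendsto_one_div_add_atTop_nhds_zero_nat (𝕜 := ℝ)).const_mul (C (m + 1))
      |>.const_sub (c m)
  -- monotone convergence
  have hmono : Tendsto (fun A : ℕ => ∫⁻ t, ENNReal.ofReal (f (A + 1) t) ∂(ρ : Measure ℝ)) atTop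
      (𝓝 (∫⁻ t, ENNReal.ofReal (t ^ m) ∂(ρ : Measure ℝ))) := by
    refine lintegral_tendsto_of_tendsto_of_monotone
      (fun A => (hfc (A + 1)).measurable.ennreal_ofReal.aemeasurable) ?_ ?_
    · refine ae_of_all _ fun t A B hAB => ENNReal.ofReal_le_ofReal ?_
      simp only [f]
      gcongr
    · filter_upwards [hρ0] with t ht
      refine (ENNReal.continuous_ofReal.tendsto _).comp ?_
      refine tendsto_const_nhds.congr' ?_
      filter_upwards [eventually_ge_atTop ⌈t⌉₊] with A hA
      have : t ≤ (A : ℝ) + 1 := (Nat.le_ceil t).trans ((Nat.cast_le.2 hA).trans (by linarith))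
      simp [f, this, ht]
  have hval : ∫⁻ t, ENNReal.ofReal (t ^ m) ∂(ρ : Measure ℝ) = ENNReal.ofReal (c m) := by
    refine tendsto_nhds_unique hmono ?_
    refine ((ENNReal.continuous_ofReal.tendsto _).comp hconv).congr fun A => ?_
    exact ofReal_integral_eq_lintegral_ofReal (hFint _ _) (ae_of_all _ (hf0 _))
  have hnn : 0 ≤ᵐ[(ρ : Measure ℝ)] fun t => t ^ m := by
    filter_upwards [hρ0] with t ht
    exact pow_nonneg ht m
  have hcm0 : 0 ≤ c m := (integral_nonneg (hf0 0)).trans (hup 0)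
  have hmeas : AEStronglyMeasurable (fun t : ℝ => t ^ m) (ρ : Measure ℝ) := by fun_prop
  refine ⟨⟨hmeas, ?_⟩, ?_⟩
  · rw [hasFiniteIntegral_iff_ofReal hnn, hval]
    exact ENNReal.ofReal_lt_top
  · rw [integral_eq_lintegral_of_nonneg_ae hnn hmeas, hval, ENNReal.toReal_ofReal hcm0]

/-! ### The mixing law -/

/-- The law of the number of tables in the Chinese restaurant process with discount `β` has
explicit rising factorial moments. -/
theorem exists_weights_rising_moments {β : ℝ} (hβ : 0 < β) (hβ' : β ≤ 1) (n : ℕ) :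
    ∃ w : ℕ → ℝ, (∀ k, 0 ≤ w k) ∧ (∀ k, n < k → w k = 0) ∧
      ∀ m : ℕ, ∑ k ∈ Finset.range (n + 1), w k * (((k + m)! : ℝ) / k !) =
        m ! * ∏ j ∈ Finset.range n, (1 + β * m / (j + 1)) := by
  induction n with
  | zero =>
    refine ⟨fun k => if k = 0 then 1 else 0, fun k => ?_, fun k hk => ?_, fun m => ?_⟩
    · dsimp only
      split_ifs <;> norm_num
    · simp [hk.ne']
    · simp
  | succ n ih =>
    obtain ⟨w, hw0, hwn, hw⟩ := ih
    -- The index is shifted by one: n+1 customers occupy k+1 tables, and the next customer opens a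
    -- new table with probability β(k+1)/(n+1). This probability is at most 1 because k ≤ n and β ≤
    -- 1.
    refine ⟨fun k => ((n + 1 - β * (k + 1)) * w k + β * k * w (k - 1)) / (n + 1),
      fun k => ?_, fun k hk => ?_, fun m => ?_⟩
    · refine div_nonneg (add_nonneg ?_ ?_) (by positivity)
      · rcases le_or_gt k n with h | h
        · refine mul_nonneg ?_ (hw0 k)
          have h1 : (k : ℝ) ≤ n := by exact_mod_cast h
          nlinarith
        · simp [hwn k h]
      · exact mul_nonneg (by positivity) (hw0 _)
    · simp [hwn k (by omega), hwn (k - 1) (by omega)]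
    · have hn : (n : ℝ) + 1 ≠ 0 := by positivity
      have h1 : ∑ k ∈ Finset.range (n + 1 + 1),
          (n + 1 - β * (k + 1)) * w k * (((k + m)! : ℝ) / k !) =
          ∑ k ∈ Finset.range (n + 1), (n + 1 - β * (k + 1)) * w k * (((k + m)! : ℝ) / k !) := by
        rw [Finset.sum_range_succ, hwn (n + 1) (by omega)]
        simp
      have h2 : ∑ k ∈ Finset.range (n + 1 + 1), β * k * w (k - 1) * (((k + m)! : ℝ) / k !) =
          ∑ k ∈ Finset.range (n + 1), β * (k + 1 + m) * w k * (((k + m)! : ℝ) / k !) := by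
        rw [Finset.sum_range_succ']
        simp only [CharP.cast_eq_zero, mul_zero, zero_mul, add_zero, Nat.add_sub_cancel]
        refine Finset.sum_congr rfl fun k _ => ?_
        have hk : (k : ℝ) + 1 ≠ 0 := by positivity
        rw [show k + 1 + m = (k + m) + 1 by ring, Nat.factorial_succ, Nat.factorial_succ]
        push_cast
        field_simp
        ring
      calc ∑ k ∈ Finset.range (n + 1 + 1),
          ((n + 1 - β * (k + 1)) * w k + β * k * w (k - 1)) / (n + 1) * (((k + m)! : ℝ) / k !)
          = (∑ k ∈ Finset.range (n + 1 + 1),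
              (n + 1 - β * (k + 1)) * w k * (((k + m)! : ℝ) / k !) +
            ∑ k ∈ Finset.range (n + 1 + 1),
              β * k * w (k - 1) * (((k + m)! : ℝ) / k !)) / (n + 1) := by
            rw [← Finset.sum_add_distrib, Finset.sum_div]
            exact Finset.sum_congr rfl fun k _ => by ring
        _ = (1 + β * m / (n + 1)) *
            ∑ k ∈ Finset.range (n + 1), w k * (((k + m)! : ℝ) / k !) := by
            rw [h1, h2, ← Finset.sum_add_distrib, Finset.sum_div, Finset.mul_sum]
            refine Finset.sum_congr rfl fun k _ => ?_
            field_simp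
            ring
        _ = _ := by
            rw [hw m, Finset.prod_range_succ]
            ring

/-- Mixing Gamma laws of shape k+1 turns the rising factorial moments of the table count into
genuine power moments. -/
theorem integrable_pow_gammaMeasure_and_integral (k m : ℕ) :
    Integrable (fun t => t ^ m) (ProbabilityTheory.gammaMeasure (k + 1) 1) ∧
      ∫ t, t ^ m ∂ProbabilityTheory.gammaMeasure (k + 1) 1 = ((k + m)! : ℝ) / k ! := by
  have hk : (0 : ℝ) < (k : ℝ) + 1 := by positivity
  have hmeas := ProbabilityTheory.measurable_gammaPDFReal ((k : ℝ) + 1) 1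
  have hfun : (fun t => ProbabilityTheory.gammaPDFReal (k + 1) 1 t * t ^ m) =
      (Set.Ici (0 : ℝ)).indicator
        (fun t => (1 / (k ! : ℝ)) * (Real.exp (-t) * t ^ (((k + m : ℕ) : ℝ) + 1 - 1))) := by
    funext t
    by_cases ht : 0 ≤ t
    · simp only [ProbabilityTheory.gammaPDFReal, ht, if_true, Set.mem_Ici, Set.indicator_of_mem,
        Real.one_rpow, Real.Gamma_nat_eq_factorial, add_sub_cancel_right, Real.rpow_natCast, one_mul]
      ring
    · simp [ProbabilityTheory.gammaPDFReal, ht]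
  have hpos : (0 : ℝ) < ((k + m : ℕ) : ℝ) + 1 := by positivity
  constructor
  · rw [ProbabilityTheory.gammaMeasure]
    unfold ProbabilityTheory.gammaPDF
    rw [integrable_withDensity_iff_integrable_smul' (by fun_prop) (by simp)]
    simp only [smul_eq_mul,
      ENNReal.toReal_ofReal (ProbabilityTheory.gammaPDFReal_nonneg hk one_pos _)]
    rw [hfun, integrable_indicator_iff measurableSet_Ici, integrableOn_Ici_iff_integrableOn_Ioi]
    exact (Real.GammaIntegral_convergent hpos).const_mul _
  · rw [ProbabilityTheory.gammaMeasure]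
    unfold ProbabilityTheory.gammaPDF
    rw [integral_withDensity_eq_integral_toReal_smul (by fun_prop) (by simp)]
    simp only [smul_eq_mul,
      ENNReal.toReal_ofReal (ProbabilityTheory.gammaPDFReal_nonneg hk one_pos _)]
    rw [hfun, integral_indicator measurableSet_Ici, integral_Ici_eq_integral_Ioi,
      integral_const_mul, ← Real.Gamma_eq_integral hpos, Real.Gamma_nat_eq_factorial]
    ring

theorem ae_nonneg_gammaMeasure (a r : ℝ) :
    ∀ᵐ t ∂ProbabilityTheory.gammaMeasure a r, 0 ≤ t := by
  have h : {t : ℝ | ¬ 0 ≤ t} = Set.Iio 0 := by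
    ext t
    simp
  rw [ae_iff, h, ProbabilityTheory.gammaMeasure, withDensity_apply _ measurableSet_Iio]
  exact ProbabilityTheory.lintegral_gammaPDF_of_nonpos le_rfl

/-- This is Euler's limit formula for the Gamma function. It supplies the limits of the rescaled
moments. -/
theorem tendsto_prod_one_add_div_mul_rpow {x : ℝ} (hx : 0 < x) :
    Tendsto (fun n : ℕ => (∏ j ∈ Finset.range n, (1 + x / (j + 1))) / (n : ℝ) ^ x) atTop
      (𝓝 (1 / Real.Gamma (x + 1))) := by
  have h1 : Tendsto (fun n => 1 / (x * Real.GammaSeq x n)) atTop (𝓝 (1 / Real.Gamma (x + 1))) := by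
    rw [Real.Gamma_add_one hx.ne']
    have := Real.Gamma_pos_of_pos hx
    exact tendsto_const_nhds.div ((Real.GammaSeq_tendsto_Gamma x).const_mul x) (by positivity)
  refine h1.congr' ?_
  filter_upwards [eventually_ge_atTop 1] with n hn
  have hn' : (0 : ℝ) < n := by exact_mod_cast hn
  have h2 : ∏ j ∈ Finset.range n, (1 + x / ((j : ℝ) + 1)) =
      (∏ j ∈ Finset.range n, (x + (j + 1))) / (n ! : ℝ) := by
    rw [← Finset.prod_range_add_one_eq_factorial]
    push_cast
    rw [← Finset.prod_div_distrib]
    refine Finset.prod_congr rfl fun j _ => ?_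
    have : (j : ℝ) + 1 ≠ 0 := by positivity
    field_simp
    ring
  have h3 : (0 : ℝ) < ∏ j ∈ Finset.range n, (x + (j + 1)) :=
    Finset.prod_pos fun j _ => by positivity
  rw [Real.GammaSeq, h2, Finset.prod_range_succ']
  have h4 : (0 : ℝ) < (n : ℝ) ^ x := by positivity
  push_cast
  field_simp
  simp

/-- For `0 < β ≤ 1` there is a probability measure on the half-line with moments
`m! / Γ(β m + 1)`. -/
theorem exists_mixing_measure {β : ℝ} (hβ : 0 < β) (hβ' : β ≤ 1) :
    ∃ ρ : Measure ℝ, IsProbabilityMeasure ρ ∧ (∀ᵐ t ∂ρ, 0 ≤ t) ∧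
      ∀ m : ℕ, Integrable (fun t => t ^ m) ρ ∧
        ∫ t, t ^ m ∂ρ = m ! / Real.Gamma (β * m + 1) := by
  choose w hw0 hwn hw using fun n => exists_weights_rising_moments hβ hβ' n
  let G : ℕ → Measure ℝ := fun k => ProbabilityTheory.gammaMeasure (k + 1) 1
  have hG : ∀ k, IsProbabilityMeasure (G k) := fun k =>
    ProbabilityTheory.isProbabilityMeasure_gammaMeasure (by positivity) one_pos
  let N : ℕ → Measure ℝ := fun n => ∑ k ∈ Finset.range (n + 1), ENNReal.ofReal (w n k) • G k
  have hNint : ∀ n m : ℕ, Integrable (fun t => t ^ m) (N n) := fun n m =>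
    integrable_finsetSum_measure.2 fun k _ =>
      (integrable_pow_gammaMeasure_and_integral k m).1.smul_measure ENNReal.ofReal_ne_top
  have hNval : ∀ n m : ℕ, ∫ t, t ^ m ∂N n =
      m ! * ∏ j ∈ Finset.range n, (1 + β * m / (j + 1)) := fun n m => by
    rw [← hw n m, integral_finsetSum_measure fun k _ =>
      (integrable_pow_gammaMeasure_and_integral k m).1.smul_measure ENNReal.ofReal_ne_top]
    refine Finset.sum_congr rfl fun k _ => ?_
    rw [integral_smul_measure, (integrable_pow_gammaMeasure_and_integral k m).2,
      ENNReal.toReal_ofReal (hw0 n k), smul_eq_mul]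
  have hNprob : ∀ n, IsProbabilityMeasure (N n) := fun n => by
    refine ⟨?_⟩
    have h1 : ∑ k ∈ Finset.range (n + 1), w n k = 1 := by
      have := hw n 0
      simpa [Nat.factorial_ne_zero] using this
    simp only [N, Measure.finsetSum_apply, Measure.smul_apply, measure_univ, smul_eq_mul, mul_one]
    rw [← ENNReal.ofReal_sum_of_nonneg fun k _ => hw0 n k, h1, ENNReal.ofReal_one]
  have hNpos : ∀ n, ∀ᵐ t ∂N n, 0 ≤ t := fun n => by
    rw [ae_iff]
    simp only [N, Measure.finsetSum_apply, Measure.smul_apply, smul_eq_mul]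
    refine Finset.sum_eq_zero fun k _ => ?_
    rw [ae_iff.1 (ae_nonneg_gammaMeasure _ _), mul_zero]
  have hdiv : ∀ n : ℕ, Measurable fun t : ℝ => t / (n : ℝ) ^ β := fun n => by fun_prop
  refine exists_isProbabilityMeasure_of_tendsto_moments
    (fun n => (N n).map fun t => t / (n : ℝ) ^ β)
    (fun n => Measure.isProbabilityMeasure_map (hdiv n).aemeasurable) (fun n => ?_)
    (fun n m => ?_) _ (fun m => ?_)
  · rw [ae_map_iff (hdiv n).aemeasurable measurableSet_Ici]
    filter_upwards [hNpos n] with t ht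
    positivity
  · rw [integrable_map_measure (by fun_prop) (hdiv n).aemeasurable]
    simp only [Function.comp_def, div_pow]
    exact (hNint n m).div_const _
  · have h1 : ∀ n : ℕ, ∫ t, t ^ m ∂((N n).map fun t => t / (n : ℝ) ^ β) =
        m ! * ((∏ j ∈ Finset.range n, (1 + β * m / (j + 1))) / (n : ℝ) ^ (β * m)) := fun n => by
      rw [integral_map (hdiv n).aemeasurable (by fun_prop)]
      simp only [div_pow]
      rw [integral_div, hNval, Real.rpow_mul (Nat.cast_nonneg n), Real.rpow_natCast, mul_div_assoc]
    simp only [h1]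
    -- The Euler limit is stated only for a positive exponent, so the total mass is treated
    -- separately.
    rcases Nat.eq_zero_or_pos m with rfl | hm
    · simp
    · have hx : 0 < β * m := by positivity
      simpa [div_eq_mul_inv] using (tendsto_prod_one_add_div_mul_rpow hx).const_mul (m ! : ℝ)

/-! ### Gaussian moments -/

open ProbabilityTheory in
theorem integrable_pow_gaussianReal (n : ℕ) :
    Integrable (fun x => x ^ n) (gaussianReal 0 1) :=
  integrable_pow_of_mem_interior_integrableExpSet (X := id) (by simp) n

-- Integration by parts, using that -φ is a primitive of xφ for the standard normal density φ.
open ProbabilityTheory in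
theorem integral_pow_add_two_gaussianReal (n : ℕ) :
    ∫ x, x ^ (n + 2) ∂gaussianReal 0 1 = (n + 1) * ∫ x, x ^ n ∂gaussianReal 0 1 := by
  have h_int : ∀ m : ℕ, Integrable fun x : ℝ => gaussianPDFReal 0 1 x * x ^ m := fun m => by
    have h := integrable_pow_gaussianReal m
    rw [gaussianReal_of_var_ne_zero _ one_ne_zero,
      integrable_withDensity_iff_integrable_smul' (by fun_prop)
        (ae_of_all _ fun _ => gaussianPDF_lt_top)] at h
    simpa only [toReal_gaussianPDF, smul_eq_mul] using h
  have hderiv : ∀ x : ℝ, HasDerivAt (fun x => -gaussianPDFReal 0 1 x)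
      (x * gaussianPDFReal 0 1 x) x := fun x => by
    have h1 : HasDerivAt (fun x : ℝ => -(x - 0) ^ 2 / (2 * ((1 : NNReal) : ℝ))) (-x) x := by
      have := (((hasDerivAt_id x).sub_const 0).pow 2).neg.div_const (2 * ((1 : NNReal) : ℝ))
      convert! this using 1
      simp only [id_eq, NNReal.coe_one]
      ring
    have h2 := (h1.exp.const_mul (√(2 * Real.pi * ((1 : NNReal) : ℝ)))⁻¹).neg
    convert! h2 using 1
    simp only [gaussianPDFReal]
    ring
  have hparts := integral_mul_deriv_eq_deriv_mul_of_integrable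
    (u := fun x : ℝ => x ^ (n + 1)) (v := fun x => -gaussianPDFReal 0 1 x)
    (u' := fun x => ((n + 1 : ℕ) : ℝ) * x ^ n) (v' := fun x => x * gaussianPDFReal 0 1 x)
    (fun x _ => by simpa using hasDerivAt_pow (n + 1) x) (fun x _ => hderiv x)
    ((h_int (n + 2)).congr (ae_of_all _ fun x => by simp only [Pi.mul_apply]; ring))
    (((h_int n).const_mul (-((n + 1 : ℕ) : ℝ))).congr
      (ae_of_all _ fun x => by simp only [Pi.mul_apply]; ring))
    ((h_int (n + 1)).neg.congr (ae_of_all _ fun x => by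
      simp only [Pi.mul_apply, Pi.neg_apply]; ring))
  rw [integral_gaussianReal_eq_integral_smul one_ne_zero,
    integral_gaussianReal_eq_integral_smul one_ne_zero, ← integral_const_mul]
  calc ∫ x, gaussianPDFReal 0 1 x • x ^ (n + 2)
      = ∫ x, x ^ (n + 1) * (x * gaussianPDFReal 0 1 x) :=
        integral_congr_ae (ae_of_all _ fun x => by simp only [smul_eq_mul]; ring)
    _ = _ := by
        rw [hparts, ← integral_neg]
        refine integral_congr_ae (ae_of_all _ fun x => ?_)
        simp only [smul_eq_mul]
        push_cast
        ring

open ProbabilityTheory in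
theorem integral_odd_pow_gaussianReal (n : ℕ) :
    ∫ x, x ^ (2 * n + 1) ∂gaussianReal 0 1 = 0 := by
  induction n with
  | zero => simp
  | succ n ih =>
    rw [show 2 * (n + 1) + 1 = 2 * n + 1 + 2 by ring, integral_pow_add_two_gaussianReal, ih, mul_zero]

/-! ### The Mittag-Leffler series as a Laplace transform -/

/-- Keep only t > R in the Gamma integral and bound t^x below by R^x. As R is free, Γ outgrows every
geometric sequence. -/
theorem rpow_mul_exp_neg_le_Gamma {R x : ℝ} (hR : 0 < R) (hx : 0 ≤ x) :
    R ^ x * Real.exp (-R) ≤ Real.Gamma (x + 1) := by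
  have h_int := Real.GammaIntegral_convergent (s := x + 1) (by linarith)
  rw [Real.Gamma_eq_integral (by linarith), ← integral_exp_neg_Ioi, ← integral_const_mul]
  have hsub : Set.Ioi R ⊆ Set.Ioi 0 := Set.Ioi_subset_Ioi hR.le
  calc ∫ t in Set.Ioi R, R ^ x * Real.exp (-t)
      ≤ ∫ t in Set.Ioi R, Real.exp (-t) * t ^ (x + 1 - 1) := by
        refine setIntegral_mono_on ?_ (h_int.mono_set hsub) measurableSet_Ioi fun t ht => ?_
        · simpa [IntegrableOn] using (exp_neg_integrableOn_Ioi R one_pos).const_mul (R ^ x)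
        · rw [mul_comm, add_sub_cancel_right]
          have : R ≤ t := le_of_lt ht
          gcongr
    _ ≤ _ := by
        refine setIntegral_mono_set h_int ?_ hsub.eventuallyLE
        filter_upwards [ae_restrict_mem measurableSet_Ioi] with t ht
        have : (0 : ℝ) < t := ht
        simp only [Pi.zero_apply]
        positivity

theorem summable_pow_div_Gamma {β : ℝ} (hβ : 0 < β) {s : ℝ} (hs : 0 ≤ s) :
    Summable fun n : ℕ => s ^ n / Real.Gamma (β * n + 1) := by
  -- Chosen so that R^(βn) = (s+1)^n, which leaves a geometric series of ratio s/(s+1).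
  let R : ℝ := (s + 1) ^ β⁻¹
  have hR : 0 < R := by positivity
  have hRβ : R ^ β = s + 1 := by
    rw [← Real.rpow_mul (by positivity), inv_mul_cancel₀ hβ.ne', Real.rpow_one]
  have hq : s / (s + 1) < 1 := by
    rw [div_lt_one (by positivity)]
    linarith
  refine Summable.of_nonneg_of_le (fun n => ?_) (fun n => ?_)
    ((summable_geometric_of_lt_one (by positivity) hq).mul_left (Real.exp R))
  · have := Real.Gamma_pos_of_pos (show 0 < β * n + 1 by positivity)
    positivity
  · have h1 := rpow_mul_exp_neg_le_Gamma hR (show 0 ≤ β * n by positivity)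
    rw [Real.rpow_mul hR.le, hRβ, Real.rpow_natCast] at h1
    calc s ^ n / Real.Gamma (β * n + 1) ≤ s ^ n / ((s + 1) ^ n * Real.exp (-R)) := by gcongr
      _ = Real.exp R * (s / (s + 1)) ^ n := by
        rw [Real.exp_neg, div_pow]
        field_simp

/-- The factor m! in the moments cancels the one in the exponential series. Absolute convergence of
the Mittag-Leffler series justifies exchanging sum and integral. -/
theorem integral_exp_neg_eq_mittagLeffler {β : ℝ} (hβ : 0 < β) {ρ : Measure ℝ}
    (hpos : ∀ᵐ t ∂ρ, 0 ≤ t)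
    (hmom : ∀ m : ℕ, Integrable (fun t => t ^ m) ρ ∧
      ∫ t, t ^ m ∂ρ = m ! / Real.Gamma (β * m + 1)) {s : ℝ} (hs : 0 ≤ s) :
    ∫ t, Complex.exp (-s * t) ∂ρ = mittagLeffler β (-s) := by
  have hF : ∀ n : ℕ, Integrable
      (fun t : ℝ => (((-s) ^ n / n ! * t ^ n : ℝ) : ℂ)) ρ := fun n =>
    ((hmom n).1.const_mul _).ofReal
  have hsum : Summable fun n : ℕ => ∫ t, ‖(((-s) ^ n / n ! * t ^ n : ℝ) : ℂ)‖ ∂ρ := by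
    refine (summable_pow_div_Gamma hβ hs).congr fun n => ?_
    have h1 : ∫ t, ‖(((-s) ^ n / n ! * t ^ n : ℝ) : ℂ)‖ ∂ρ = ∫ t, s ^ n / n ! * t ^ n ∂ρ := by
      refine integral_congr_ae ?_
      filter_upwards [hpos] with t ht
      rw [Complex.norm_real, Real.norm_eq_abs, abs_mul, abs_div, abs_pow, abs_neg, abs_of_nonneg hs,
        abs_of_nonneg (by positivity : (0 : ℝ) ≤ n !), abs_of_nonneg (pow_nonneg ht n)]
    rw [h1, integral_const_mul, (hmom n).2]
    have := n.factorial_ne_zero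
    field_simp
  have h := hasSum_integral_of_summable_integral_norm hF hsum
  have h2 : ∫ t : ℝ, Complex.exp (-s * t) ∂ρ =
      ∫ t : ℝ, ∑' n : ℕ, (((-s) ^ n / n ! * t ^ n : ℝ) : ℂ) ∂ρ := by
    refine integral_congr_ae (ae_of_all _ fun t => ?_)
    simp only
    rw [Complex.exp_eq_exp_ℂ, NormedSpace.exp_eq_tsum_div]
    refine tsum_congr fun n => ?_
    push_cast
    rw [mul_pow]
    ring
  rw [h2, ← h.tsum_eq, mittagLeffler]
  refine tsum_congr fun n => ?_
  rw [integral_complex_ofReal, integral_const_mul, (hmom n).2]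
  have h3 : Complex.Gamma (β * n + 1) = (Real.Gamma (β * n + 1) : ℂ) := by
    rw [← Complex.Gamma_ofReal]
    push_cast
    rfl
  rw [h3]
  push_cast
  have : (n ! : ℂ) ≠ 0 := by exact_mod_cast n.factorial_ne_zero
  field_simp

/-! ### The Gamma function inequality -/

theorem intervalIntegrable_and_integral_rpow_mul_one_sub_rpow {a b : ℝ} (ha : -1 < a) (hb : -1 < b) :
    IntervalIntegrable (fun x : ℝ => x ^ a * (1 - x) ^ b) volume 0 1 ∧
      ∫ x in (0 : ℝ)..1, x ^ a * (1 - x) ^ b =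
        Real.Gamma (a + 1) * Real.Gamma (b + 1) / Real.Gamma (a + b + 2) := by
  have hau : 0 < ((a + 1 : ℝ) : ℂ).re := by simpa using by linarith
  have hbu : 0 < ((b + 1 : ℝ) : ℂ).re := by simpa using by linarith
  have hcongr : ∀ x ∈ Set.uIcc (0 : ℝ) 1,
      (x : ℂ) ^ (((a + 1 : ℝ) : ℂ) - 1) * (1 - (x : ℂ)) ^ (((b + 1 : ℝ) : ℂ) - 1) =
        ((x ^ a * (1 - x) ^ b : ℝ) : ℂ) := by
    intro x hx
    rw [Set.uIcc_of_le zero_le_one] at hx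
    have h1 : 0 ≤ 1 - x := by linarith [hx.2]
    rw [Complex.ofReal_mul, Complex.ofReal_cpow hx.1, Complex.ofReal_cpow h1]
    push_cast
    simp
  constructor
  · have h := (Complex.betaIntegral_convergent hau hbu).congr
      (g := fun x : ℝ => ((x ^ a * (1 - x) ^ b : ℝ) : ℂ))
      (fun x hx => hcongr x (Set.uIoc_subset_uIcc hx))
    rw [intervalIntegrable_iff] at h ⊢
    exact h.re
  · have h := Complex.betaIntegral_eq_Gamma_mul_div _ _ hau hbu
    rw [Complex.betaIntegral, intervalIntegral.integral_congr hcongr,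
      intervalIntegral.integral_ofReal, ← Complex.ofReal_add, Complex.Gamma_ofReal,
      Complex.Gamma_ofReal, Complex.Gamma_ofReal] at h
    rw [show a + b + 2 = a + 1 + (b + 1) by ring]
    exact_mod_cast h

/-- After division by Γ₁Γ₂, where Γₖ = Γ(kβ+1), the claim is 3Γ₁ - 3Γ₂/Γ₁ + Γ₃/Γ₂ > 0. Multiplied by
Γ(1-β), each term becomes a Beta integral with the common weight (1-x)^(-β). With q = x^β, the
combined integrand is this weight times q(3 - 3(β+1)q + (2β+1)q²), which is positive on (0,1). -/
theorem three_mul_Gamma_sq_lt {β : ℝ} (hβ : 0 < β) (hβ' : β < 1) :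
    3 * Real.Gamma (β * 2 + 1) ^ 2 <
      Real.Gamma (β + 1) * Real.Gamma (β * 3 + 1) +
        3 * Real.Gamma (β + 1) ^ 2 * Real.Gamma (β * 2 + 1) := by
  have hb : -1 < -β := by linarith
  obtain ⟨i1, e1⟩ := intervalIntegrable_and_integral_rpow_mul_one_sub_rpow
    (show -1 < β by linarith) hb
  obtain ⟨i2, e2⟩ := intervalIntegrable_and_integral_rpow_mul_one_sub_rpow
    (show -1 < β * 2 by linarith) hb
  obtain ⟨i3, e3⟩ := intervalIntegrable_and_integral_rpow_mul_one_sub_rpow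
    (show -1 < β * 3 by linarith) hb
  rw [show β + -β + 2 = (2 : ℝ) by ring, Real.Gamma_two] at e1
  rw [show β * 2 + -β + 2 = β + 1 + 1 by ring, Real.Gamma_add_one (s := β + 1) (by linarith)] at e2
  rw [show β * 3 + -β + 2 = β * 2 + 1 + 1 by ring,
    Real.Gamma_add_one (s := β * 2 + 1) (by linarith)] at e3
  have hg : 0 < Real.Gamma (-β + 1) := Real.Gamma_pos_of_pos (by linarith)
  have h1 : 0 < Real.Gamma (β + 1) := Real.Gamma_pos_of_pos (by linarith)
  have h2 : 0 < Real.Gamma (β * 2 + 1) := Real.Gamma_pos_of_pos (by linarith)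
  have hpos : 0 < ∫ x in (0 : ℝ)..1, (3 * (x ^ β * (1 - x) ^ (-β)) +
      -(3 * (β + 1)) * (x ^ (β * 2) * (1 - x) ^ (-β)) +
      (β * 2 + 1) * (x ^ (β * 3) * (1 - x) ^ (-β))) := by
    refine intervalIntegral.intervalIntegral_pos_of_pos_on
      (((i1.const_mul _).add (i2.const_mul _)).add (i3.const_mul _)) (fun x hx => ?_) one_pos
    have hx0 : 0 < x := hx.1
    have hx1 : 0 < 1 - x := by linarith [hx.2]
    have hq : 0 < x ^ β := by positivity
    have hr : 0 < (1 - x) ^ (-β) := by positivity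
    rw [Real.rpow_mul hx0.le, Real.rpow_mul hx0.le, Real.rpow_ofNat, Real.rpow_ofNat]
    set q := x ^ β
    -- The discriminant of the quadratic in q is -3(3β+1)(1-β) < 0.
    have hquad : 0 < 3 - 3 * (β + 1) * q + (β * 2 + 1) * q ^ 2 := by
      nlinarith [sq_nonneg (2 * (β * 2 + 1) * q - 3 * (β + 1)),
        mul_pos (show 0 < 3 * β + 1 by linarith) (show 0 < 1 - β by linarith)]
    have : 0 < (1 - x) ^ (-β) * q * (3 - 3 * (β + 1) * q + (β * 2 + 1) * q ^ 2) := by positivity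
    calc 0 < _ := this
      _ = _ := by ring
  rw [intervalIntegral.integral_add ((i1.const_mul _).add (i2.const_mul _)) (i3.const_mul _),
    intervalIntegral.integral_add (i1.const_mul _) (i2.const_mul _),
    intervalIntegral.integral_const_mul, intervalIntegral.integral_const_mul,
    intervalIntegral.integral_const_mul, e1, e2, e3] at hpos
  have hβ1 : β + 1 ≠ 0 := by linarith
  have hβ2 : β * 2 + 1 ≠ 0 := by linarith
  have hmul := mul_pos (mul_pos h1 h2) hpos
  have hid : Real.Gamma (β + 1) * Real.Gamma (β * 2 + 1) *
      (3 * (Real.Gamma (β + 1) * Real.Gamma (-β + 1) / 1) +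
        -(3 * (β + 1)) * (Real.Gamma (β * 2 + 1) * Real.Gamma (-β + 1) /
          ((β + 1) * Real.Gamma (β + 1))) +
        (β * 2 + 1) * (Real.Gamma (β * 3 + 1) * Real.Gamma (-β + 1) /
          ((β * 2 + 1) * Real.Gamma (β * 2 + 1)))) =
      Real.Gamma (-β + 1) * (Real.Gamma (β + 1) * Real.Gamma (β * 3 + 1) +
        3 * Real.Gamma (β + 1) ^ 2 * Real.Gamma (β * 2 + 1) -
        3 * Real.Gamma (β * 2 + 1) ^ 2) := by
    field_simp
    ring
  rw [hid] at hmul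
  linarith [(mul_pos_iff_of_pos_left hg).1 hmul]

/-! ### The Mittag-Leffler measure as a Gaussian mixture -/

theorem IsMittagLefflerMeasure.mittagLefflerMeasure_eq {E : Type*} [NormedAddCommGroup E]
    [InnerProductSpace ℝ E] [FiniteDimensional ℝ E] [MeasurableSpace E] [BorelSpace E] {β : ℝ}
    {μ : Measure E} (hμ : IsMittagLefflerMeasure β μ) : mittagLefflerMeasure β E = μ := by
  have h : ∃ μ : Measure E, IsMittagLefflerMeasure β μ := ⟨μ, hμ⟩
  rw [mittagLefflerMeasure, dif_pos h]
  exact h.choose_spec.unique hμ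

theorem EuclideanSpace.inner_self_fin_two (p : EuclideanSpace ℝ (Fin 2)) :
    inner ℝ p p = p 0 ^ 2 + p 1 ^ 2 := by
  rw [real_inner_self_eq_norm_sq, EuclideanSpace.real_norm_sq_eq, Fin.sum_univ_two]

/-- The characteristic function of the marginal is the planar one restricted to the vectors (p, 0).
Hence the moments on the line can be read off from the planar ones. -/
theorem IsMittagLefflerMeasure.map_apply_zero {β : ℝ} {μ : Measure (EuclideanSpace ℝ (Fin 2))}
    (hμ : IsMittagLefflerMeasure β μ) : IsMittagLefflerMeasure β (μ.map fun v => v 0) := by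
  have hm : Measurable fun v : EuclideanSpace ℝ (Fin 2) => v 0 := by fun_prop
  have := hμ.1
  refine ⟨Measure.isProbabilityMeasure_map hm.aemeasurable, fun p => ?_⟩
  have h := hμ.2 !₂[p, 0]
  rw [charFun_apply, EuclideanSpace.inner_self_fin_two] at h
  rw [charFun_apply]
  rw [integral_map hm.aemeasurable (by fun_prop)]
  simpa [PiLp.inner_apply, Fin.sum_univ_two] using h

open ProbabilityTheory in
theorem charFun_gaussianReal_sqrt_mul {t : ℝ} (ht : 0 ≤ t) (p : ℝ) :
    ∫ x : ℝ, Complex.exp (((√t * x * p : ℝ) : ℂ) * Complex.I) ∂gaussianReal 0 1 =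
      Complex.exp (-((p ^ 2 / 2 : ℝ) : ℂ) * t) := by
  have h := charFun_gaussianReal (μ := 0) (v := 1) (√t * p)
  rw [charFun_apply_real] at h
  calc _ = ∫ x : ℝ, Complex.exp (((√t * p : ℝ) : ℂ) * x * Complex.I) ∂gaussianReal 0 1 := by
        refine integral_congr_ae (ae_of_all _ fun x => ?_)
        simp only
        push_cast
        congr 1
        ring
    _ = _ := by
        rw [h]
        congr 1
        have hsq : ((√t : ℝ) : ℂ) ^ 2 = t := by
          rw [← Complex.ofReal_pow, Real.sq_sqrt ht]
        push_cast
        rw [mul_pow, hsq]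
        ring

open ProbabilityTheory in
/-- The planar Mittag-Leffler measure exists, as a Gaussian mixture, and its mixed moments are
those of the mixing law times those of the standard Gaussian law. -/
theorem exists_isMittagLefflerMeasure_moments {β : ℝ} (hβ : 0 < β) (hβ' : β ≤ 1) :
    ∃ μ : Measure (EuclideanSpace ℝ (Fin 2)), IsMittagLefflerMeasure β μ ∧
      ∃ c : ℕ → ℝ, (∀ k : ℕ, c (2 * k) = k ! / Real.Gamma (β * k + 1)) ∧
        ∀ a b : ℕ, Integrable (fun v => v 0 ^ a * v 1 ^ b) μ ∧
          ∫ v, v 0 ^ a * v 1 ^ b ∂μ =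
            c (a + b) * ((∫ x, x ^ a ∂gaussianReal 0 1) * ∫ x, x ^ b ∂gaussianReal 0 1) := by
  obtain ⟨ρ, hρ, hpos, hmom⟩ := exists_mixing_measure hβ hβ'
  let γ : Measure ℝ := gaussianReal 0 1
  let S : ℝ × ℝ × ℝ → EuclideanSpace ℝ (Fin 2) := fun q => !₂[√q.1 * q.2.1, √q.1 * q.2.2]
  have hS : Measurable S := by
    refine (WithLp.measurable_toLp 2 _).comp (measurable_pi_iff.2 fun i => ?_)
    fin_cases i <;> simp <;> fun_prop
  let μ := (ρ.prod (γ.prod γ)).map S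
  have hμ : IsProbabilityMeasure μ := Measure.isProbabilityMeasure_map hS.aemeasurable
  refine ⟨μ, ⟨hμ, fun p => ?_⟩, fun k => ∫ t, √t ^ k ∂ρ, fun k => ?_, fun a b => ?_⟩
  · rw [charFun_apply, integral_map hS.aemeasurable (by fun_prop)]
    have hs : 0 ≤ (p 0 ^ 2 + p 1 ^ 2) / 2 := by positivity
    have harg : (-(1 / 2) * ((inner ℝ p p : ℝ) : ℂ)) = -(((p 0 ^ 2 + p 1 ^ 2) / 2 : ℝ) : ℂ) := by
      rw [EuclideanSpace.inner_self_fin_two]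
      push_cast
      ring
    rw [harg, ← integral_exp_neg_eq_mittagLeffler hβ hpos hmom hs]
    have h_int : Integrable (fun q : ℝ × ℝ × ℝ =>
        Complex.exp (((inner ℝ (S q) p : ℝ) : ℂ) * Complex.I)) (ρ.prod (γ.prod γ)) := by
      refine (integrable_const (1 : ℝ)).mono' ?_ (ae_of_all _ fun q => ?_)
      · have : Measurable fun q : ℝ × ℝ × ℝ => (inner ℝ (S q) p : ℝ) := hS.inner measurable_const
        fun_prop
      · rw [Complex.norm_exp_ofReal_mul_I]
    rw [integral_prod _ h_int]
    refine integral_congr_ae ?_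
    -- For fixed t the inner integral is the characteristic function of a centred Gaussian vector of
    -- covariance t·I, which splits over the coordinates.
    filter_upwards [hpos] with t ht
    have hsplit : ∀ z : ℝ × ℝ, Complex.exp (((inner ℝ (S (t, z)) p : ℝ) : ℂ) * Complex.I) =
        Complex.exp (((√t * z.1 * p 0 : ℝ) : ℂ) * Complex.I) *
          Complex.exp (((√t * z.2 * p 1 : ℝ) : ℂ) * Complex.I) := fun z => by
      rw [← Complex.exp_add]
      congr 1
      simp [S, PiLp.inner_apply, Fin.sum_univ_two]
      ring
    simp only [hsplit]
    rw [integral_prod_mul (fun x : ℝ => Complex.exp (((√t * x * p 0 : ℝ) : ℂ) * Complex.I))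
      (fun x : ℝ => Complex.exp (((√t * x * p 1 : ℝ) : ℂ) * Complex.I)),
      charFun_gaussianReal_sqrt_mul ht, charFun_gaussianReal_sqrt_mul ht, ← Complex.exp_add]
    congr 1
    push_cast
    ring
  · rw [← (hmom k).2]
    refine integral_congr_ae ?_
    filter_upwards [hpos] with t ht
    rw [pow_mul, Real.sq_sqrt ht]
  · have hsqrt : ∀ k : ℕ, Integrable (fun t => √t ^ k) ρ := fun k => by
      -- Half-integer moments are dominated through √t^k ≤ 1 + t^k.
      refine ((hmom 0).1.add (hmom k).1).mono' (by fun_prop) ?_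
      filter_upwards [hpos] with t ht
      rw [Real.norm_of_nonneg (by positivity)]
      simp only [Pi.add_apply, pow_zero]
      rcases le_total t 1 with h | h
      · have : √t ^ k ≤ 1 := pow_le_one₀ (by positivity) (Real.sqrt_le_one.2 h)
        have : 0 ≤ t ^ k := by positivity
        linarith
      · have : √t ^ k ≤ t ^ k := by
          gcongr
          exact Real.sqrt_le_iff.2 ⟨ht, by nlinarith⟩
        linarith
    have hfun : (fun q : ℝ × ℝ × ℝ => (S q) 0 ^ a * (S q) 1 ^ b) =
        fun q => √q.1 ^ (a + b) * (q.2.1 ^ a * q.2.2 ^ b) := by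
      funext q
      simp only [S, Matrix.cons_val_zero, Matrix.cons_val_one]
      ring
    have hm : Measurable fun v : EuclideanSpace ℝ (Fin 2) => v 0 ^ a * v 1 ^ b := by fun_prop
    constructor
    · rw [integrable_map_measure hm.aestronglyMeasurable hS.aemeasurable]
      change Integrable (fun q : ℝ × ℝ × ℝ => (S q) 0 ^ a * (S q) 1 ^ b) _
      rw [hfun]
      exact (hsqrt (a + b)).mul_prod
        ((integrable_pow_gaussianReal a).mul_prod (integrable_pow_gaussianReal b))
    · rw [integral_map hS.aemeasurable hm.aestronglyMeasurable, hfun,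
        integral_prod_mul (fun t : ℝ => √t ^ (a + b)) (fun z : ℝ × ℝ => z.1 ^ a * z.2 ^ b),
        integral_prod_mul (fun x : ℝ => x ^ a) (fun y : ℝ => y ^ b)]

/-! ### Low-degree orthogonal polynomials -/

/-- The orthogonal polynomials of degrees two and four of a law on the line with vanishing odd
moments. -/
theorem gramSchmidtPoly_of_odd_moments_eq_zero {μ : Measure ℝ} [IsProbabilityMeasure μ]
    (h_int : ∀ n : ℕ, Integrable (fun x => x ^ n) μ)
    (hodd : ∀ n : ℕ, ∫ x, x ^ (2 * n + 1) ∂μ = 0) {m₂ m₄ m₆ : ℝ} (h₂ : ∫ x, x ^ 2 ∂μ = m₂)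
    (h₄ : ∫ x, x ^ 4 ∂μ = m₄) (h₆ : ∫ x, x ^ 6 ∂μ = m₆) :
    (∀ x, (gramSchmidtPoly μ 2).eval x = x ^ 2 - m₂) ∧
      ∀ x, (gramSchmidtPoly μ 4).eval x =
        x ^ 4 - (m₆ - m₄ * m₂) / (m₄ - m₂ ^ 2) * (x ^ 2 - m₂) - m₄ := by
  have h1 : ∫ x, x ∂μ = 0 := by simpa using hodd 0
  have h3 : ∫ x, x ^ 3 ∂μ = 0 := hodd 1
  have h5 : ∫ x, x ^ 5 ∂μ = 0 := hodd 2
  have h7 : ∫ x, x ^ 7 ∂μ = 0 := hodd 3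
  have e0 : gramSchmidtPoly μ 0 = 1 := by
    rw [gramSchmidtPoly]
    simp
  have e1 : gramSchmidtPoly μ 1 = Polynomial.X := by
    rw [gramSchmidtPoly]
    simp [e0, h1]
  have e2 : gramSchmidtPoly μ 2 = Polynomial.X ^ 2 - Polynomial.C m₂ := by
    have : ∫ x, x ^ 2 * x ∂μ = 0 := by simpa only [← pow_succ] using h3
    rw [gramSchmidtPoly]
    simp [Fin.sum_univ_two, e0, e1, h₂, this]
  -- The cubic serves only to show that its contribution to degree four vanishes by parity. No
  -- nonvanishing of m₂ is needed.
  have e3 : gramSchmidtPoly μ 3 = Polynomial.X ^ 3 - Polynomial.C (m₄ / m₂) * Polynomial.X := by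
    have i1 : ∫ x, x ^ 3 * x ∂μ = m₄ := by simpa only [← pow_succ] using h₄
    have i2 : ∫ x, x ^ 3 * (x ^ 2 - m₂) ∂μ = 0 := by
      have : ∀ x : ℝ, x ^ 3 * (x ^ 2 - m₂) = x ^ 5 - m₂ * x ^ 3 := fun x => by ring
      simp only [this]
      rw [integral_sub (h_int 5) ((h_int 3).const_mul _), integral_const_mul, h5, h3]
      simp
    rw [gramSchmidtPoly]
    simp [Fin.sum_univ_three, e0, e1, e2, h₂, h3, i1, i2]
  have e4 : gramSchmidtPoly μ 4 = Polynomial.X ^ 4 - (Polynomial.C m₄ +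
      Polynomial.C ((m₆ - m₄ * m₂) / (m₄ - m₂ ^ 2)) * (Polynomial.X ^ 2 - Polynomial.C m₂)) := by
    have i1 : ∫ x, x ^ 4 * x ∂μ = 0 := by simpa only [← pow_succ] using h5
    have i2 : ∫ x, x ^ 4 * (x ^ 2 - m₂) ∂μ = m₆ - m₄ * m₂ := by
      have : ∀ x : ℝ, x ^ 4 * (x ^ 2 - m₂) = x ^ 6 - m₂ * x ^ 4 := fun x => by ring
      simp only [this]
      rw [integral_sub (h_int 6) ((h_int 4).const_mul _), integral_const_mul, h₆, h₄]
      ring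
    have i3 : ∫ x, (x ^ 2 - m₂) ^ 2 ∂μ = m₄ - m₂ ^ 2 := by
      have : ∀ x : ℝ, (x ^ 2 - m₂) ^ 2 = x ^ 4 - 2 * m₂ * x ^ 2 + m₂ ^ 2 := fun x => by ring
      simp only [this]
      have hi : Integrable (fun x : ℝ => x ^ 4 - 2 * m₂ * x ^ 2) μ :=
        (h_int 4).sub ((h_int 2).const_mul _)
      rw [integral_add hi (integrable_const _),
        integral_sub (h_int 4) ((h_int 2).const_mul _), integral_const_mul, h₄, h₂]
      simp
      ring
    have i4 : ∫ x, x ^ 4 * (x ^ 3 - m₄ / m₂ * x) ∂μ = 0 := by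
      have : ∀ x : ℝ, x ^ 4 * (x ^ 3 - m₄ / m₂ * x) = x ^ 7 - m₄ / m₂ * x ^ 5 := fun x => by ring
      simp only [this]
      rw [integral_sub (h_int 7) ((h_int 5).const_mul _), integral_const_mul, h7, h5]
      simp
    rw [gramSchmidtPoly]
    simp [Fin.sum_univ_four, e0, e1, e2, e3, h₄, i1, i2, i3, i4]
  refine ⟨fun x => by simp [e2], fun x => ?_⟩
  rw [e4]
  simp
  ring

/-- Nonnegativity of the variance of the mixing law. It yields the nonzero denominator in H₄. -/
theorem Gamma_two_mul_add_one_le {β : ℝ} (hβ : 0 < β) (hβ' : β ≤ 1) :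
    Real.Gamma (β * 2 + 1) ≤ 2 * Real.Gamma (β + 1) ^ 2 := by
  obtain ⟨ρ, hρ, -, hmom⟩ := exists_mixing_measure hβ hβ'
  have h1 := hmom 1
  have h2 := hmom 2
  simp only [pow_one, Nat.cast_one, mul_one, Nat.factorial_one, Nat.factorial_two,
    Nat.cast_ofNat] at h1 h2
  have hvar := ProbabilityTheory.variance_nonneg (fun t : ℝ => t) ρ
  rw [ProbabilityTheory.variance_eq_sub ((memLp_two_iff_integrable_sq (by fun_prop)).2 h2.1)] at hvar
  simp only [Pi.pow_apply, h1.2, h2.2] at hvar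
  have g1 : 0 < Real.Gamma (β + 1) := Real.Gamma_pos_of_pos (by linarith)
  have g2 : 0 < Real.Gamma (β * 2 + 1) := Real.Gamma_pos_of_pos (by linarith)
  rw [sub_nonneg, div_pow, one_pow, div_le_div_iff₀ (by positivity) g2] at hvar
  linarith

/-! ### Evaluation of the integral -/

theorem mainTheorem3 (β : ℝ) (hβ : 0 < β) (hβ' : β ≤ 1) :
    Integrable (fun v : EuclideanSpace ℝ (Fin 2) =>
        (mittagLefflerPoly β 4).eval (v 0) * (mittagLefflerPoly β 2).eval (v 1))
      (mittagLefflerMeasure β (EuclideanSpace ℝ (Fin 2))) ∧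
    ((∫ v : EuclideanSpace ℝ (Fin 2),
        (mittagLefflerPoly β 4).eval (v 0) * (mittagLefflerPoly β 2).eval (v 1)
          ∂(mittagLefflerMeasure β (EuclideanSpace ℝ (Fin 2)))) = 0 ↔ β = 1) := by
  obtain ⟨μ, hμ, c, hc, hmom⟩ := exists_isMittagLefflerMeasure_moments hβ hβ'
  have hline := hμ.map_apply_zero
  have hproj : Measurable fun v : EuclideanSpace ℝ (Fin 2) => v 0 := by fun_prop
  have := hμ.1
  have := hline.1
  -- Gaussian moments
  have g0 : ∫ x, x ^ 0 ∂ProbabilityTheory.gaussianReal 0 1 = 1 := by simp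
  have g2 : ∫ x, x ^ 2 ∂ProbabilityTheory.gaussianReal 0 1 = 1 := by
    have := integral_pow_add_two_gaussianReal 0
    rw [g0] at this
    simpa using this
  have g4 : ∫ x, x ^ 4 ∂ProbabilityTheory.gaussianReal 0 1 = 3 := by
    have := integral_pow_add_two_gaussianReal 2
    rw [g2] at this
    norm_num at this
    exact this
  have g6 : ∫ x, x ^ 6 ∂ProbabilityTheory.gaussianReal 0 1 = 15 := by
    have := integral_pow_add_two_gaussianReal 4
    rw [g4] at this
    norm_num at this
    exact this
  -- moments of the law on the line
  have h_int : ∀ n : ℕ, Integrable (fun x => x ^ n) (μ.map fun v => v 0) := fun n => by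
    rw [integrable_map_measure (by fun_prop) hproj.aemeasurable]
    simpa using! (hmom n 0).1
  have hval : ∀ n : ℕ, ∫ x, x ^ n ∂(μ.map fun v => v 0) =
      c n * ∫ x, x ^ n ∂ProbabilityTheory.gaussianReal 0 1 := fun n => by
    rw [integral_map hproj.aemeasurable (by fun_prop)]
    simpa using (hmom n 0).2
  have hodd : ∀ n : ℕ, ∫ x, x ^ (2 * n + 1) ∂(μ.map fun v => v 0) = 0 := fun n => by
    rw [hval, integral_odd_pow_gaussianReal, mul_zero]
  obtain ⟨hH2, hH4⟩ := gramSchmidtPoly_of_odd_moments_eq_zero h_int hodd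
    ((hval 2).trans (by rw [g2, mul_one])) ((hval 4).trans (by rw [g4])) ((hval 6).trans (by rw [g6]))
  set q : ℝ := (c 6 * 15 - c 4 * 3 * c 2) / (c 4 * 3 - c 2 ^ 2)
  simp only [mittagLefflerPoly, hline.mittagLefflerMeasure_eq, hμ.mittagLefflerMeasure_eq, hH2, hH4]
  have hexpand : ∀ v : EuclideanSpace ℝ (Fin 2),
      (v 0 ^ 4 - q * (v 0 ^ 2 - c 2) - c 4 * 3) * (v 1 ^ 2 - c 2) =
        v 0 ^ 4 * v 1 ^ 2 + -c 2 * (v 0 ^ 4 * v 1 ^ 0) + -q * (v 0 ^ 2 * v 1 ^ 2) +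
          q * c 2 * (v 0 ^ 2 * v 1 ^ 0) + (q * c 2 - c 4 * 3) * (v 0 ^ 0 * v 1 ^ 2) +
          -((q * c 2 - c 4 * 3) * c 2) * (v 0 ^ 0 * v 1 ^ 0) := fun v => by ring
  simp only [hexpand]
  have i1 : Integrable (fun v : EuclideanSpace ℝ (Fin 2) =>
      v 0 ^ 4 * v 1 ^ 2 + -c 2 * (v 0 ^ 4 * v 1 ^ 0)) μ :=
    (hmom 4 2).1.add ((hmom 4 0).1.const_mul _)
  have i2 : Integrable (fun v : EuclideanSpace ℝ (Fin 2) =>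
      v 0 ^ 4 * v 1 ^ 2 + -c 2 * (v 0 ^ 4 * v 1 ^ 0) +
      -q * (v 0 ^ 2 * v 1 ^ 2)) μ :=
    i1.add ((hmom 2 2).1.const_mul _)
  have i3 : Integrable (fun v : EuclideanSpace ℝ (Fin 2) =>
      v 0 ^ 4 * v 1 ^ 2 + -c 2 * (v 0 ^ 4 * v 1 ^ 0) +
      -q * (v 0 ^ 2 * v 1 ^ 2) +
      q * c 2 * (v 0 ^ 2 * v 1 ^ 0)) μ :=
    i2.add ((hmom 2 0).1.const_mul _)
  have i4 : Integrable (fun v : EuclideanSpace ℝ (Fin 2) =>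
      v 0 ^ 4 * v 1 ^ 2 + -c 2 * (v 0 ^ 4 * v 1 ^ 0) +
      -q * (v 0 ^ 2 * v 1 ^ 2) +
      q * c 2 * (v 0 ^ 2 * v 1 ^ 0) +
      (q * c 2 - c 4 * 3) * (v 0 ^ 0 * v 1 ^ 2)) μ :=
    i3.add ((hmom 0 2).1.const_mul _)
  have i5 := (hmom 0 0).1.const_mul (-((q * c 2 - c 4 * 3) * c 2))
  refine ⟨i4.add i5, ?_⟩
  have hc0 := hc 0
  have hc2 := hc 1
  have hc4 := hc 2
  have hc6 := hc 3
  norm_num [Nat.factorial] at hc0 hc2 hc4 hc6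
  have hI : ∫ v : EuclideanSpace ℝ (Fin 2), (v 0 ^ 4 * v 1 ^ 2 + -c 2 * (v 0 ^ 4 * v 1 ^ 0) +
      -q * (v 0 ^ 2 * v 1 ^ 2) + q * c 2 * (v 0 ^ 2 * v 1 ^ 0) +
      (q * c 2 - c 4 * 3) * (v 0 ^ 0 * v 1 ^ 2) +
      -((q * c 2 - c 4 * 3) * c 2) * (v 0 ^ 0 * v 1 ^ 0)) ∂μ =
      3 * c 6 - 3 * (c 2 * c 4) - q * (c 4 - c 2 ^ 2) := by
    rw [integral_add i4 i5, integral_add i3 ((hmom 0 2).1.const_mul _),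
      integral_add i2 ((hmom 2 0).1.const_mul _), integral_add i1 ((hmom 2 2).1.const_mul _),
      integral_add (hmom 4 2).1 ((hmom 4 0).1.const_mul _)]
    simp only [integral_const_mul, (hmom _ _).2, g0, g2, g4, Nat.add_zero, Nat.zero_add,
      Nat.reduceAdd, hc0]
    ring
  rw [hI]
  have G1 : 0 < Real.Gamma (β + 1) := Real.Gamma_pos_of_pos (by linarith)
  have G2 : 0 < Real.Gamma (β * 2 + 1) := Real.Gamma_pos_of_pos (by linarith)
  have G3 : 0 < Real.Gamma (β * 3 + 1) := Real.Gamma_pos_of_pos (by linarith)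
  -- This is the variance of x² under the law on the line.
  have hD : 0 < c 4 * 3 - c 2 ^ 2 := by
    have h := Gamma_two_mul_add_one_le hβ hβ'
    have h' : c 4 * 3 - c 2 ^ 2 = (6 * Real.Gamma (β + 1) ^ 2 - Real.Gamma (β * 2 + 1)) /
        (Real.Gamma (β + 1) ^ 2 * Real.Gamma (β * 2 + 1)) := by
      rw [hc2, hc4]
      field_simp
      ring
    rw [h']
    refine div_pos ?_ (by positivity)
    nlinarith
  have hkey : 3 * c 6 - 3 * (c 2 * c 4) - q * (c 4 - c 2 ^ 2) =
      24 * (3 * Real.Gamma (β * 2 + 1) ^ 2 - (Real.Gamma (β + 1) * Real.Gamma (β * 3 + 1) +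
        3 * Real.Gamma (β + 1) ^ 2 * Real.Gamma (β * 2 + 1))) /
        (Real.Gamma (β + 1) ^ 2 * Real.Gamma (β * 2 + 1) ^ 2 * Real.Gamma (β * 3 + 1)) /
        (c 4 * 3 - c 2 ^ 2) := by
    rw [eq_div_iff hD.ne']
    -- Clearing the denominator of q cancels the c₂³c₄ terms and leaves a polynomial in the three
    -- moments of T.
    have h1 : (3 * c 6 - 3 * (c 2 * c 4) - q * (c 4 - c 2 ^ 2)) * (c 4 * 3 - c 2 ^ 2) =
        6 * (2 * c 2 ^ 2 * c 6 - c 4 * c 6 - c 2 * c 4 ^ 2) := by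
      have hqD : q * (c 4 * 3 - c 2 ^ 2) = c 6 * 15 - c 4 * 3 * c 2 := div_mul_cancel₀ _ hD.ne'
      linear_combination (-(c 4 - c 2 ^ 2)) * hqD
    rw [h1, hc2, hc4, hc6]
    field_simp
    ring
  rw [hkey]
  constructor
  · intro h
    by_contra hne
    have hlt := three_mul_Gamma_sq_lt hβ (lt_of_le_of_ne hβ' hne)
    refine absurd h (ne_of_lt (div_neg_of_neg_of_pos (div_neg_of_neg_of_pos ?_ (by positivity)) hD))
    linarith
  -- At β = 1 the Gamma values are 1, 2 and 6, and the bracket is 3·4 - (6 + 6) = 0.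
  · rintro rfl
    have e1 : Real.Gamma (1 + 1) = 1 := by norm_num
    have e2 : Real.Gamma (1 * 2 + 1) = 2 := by
      simpa [Nat.factorial] using Real.Gamma_nat_eq_factorial 2
    have e3 : Real.Gamma (1 * 3 + 1) = 6 := by
      simpa [Nat.factorial] using Real.Gamma_nat_eq_factorial 3
    rw [e1, e2, e3]
    norm_num
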